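/- Let $A$ be an abelian variety over a field $\Bbbk$ (a smooth, connected, proper $\Bbbk$-group scheme), with addition $s:A\times A\to A$, zero $0:\operatorname{Spec}\Bbbk\to A$ and inversion $\operatorname{op}:A\to A$; products without subscript are over $\Bbbk$. Let $\mathrm{Sch}|_{qc}A$ be the category of quasi-compact morphisms $x:X\to A$ of $\Bbbk$-schemes, with $A$-morphisms as arrows. It is a duoidal category for the Cauchy product $x\,\widetilde\times\,y=s\circ(x\times y):X\times Y\to A$, with unit $\mathbb I_{\widetilde\times}=(0:\operatorname{Spec}\Bbbk\to A)$, and the fibered product $x\times_A y$, with unit $\mathbb I_{\times_A}=(\mathrm{id}:A\to A)$; the interchange law $(x\times_A y)\,\widetilde\times\,(z\times_A w)\to(x\,\widetilde\times\,z)\times_A(y\,\widetilde\times\,w)$ is induced by $p_X\times p_Z$ and $p_Y\times p_W$, the multiplication and the unit of $\mathbb I_{\times_A}$ are $s$ and $0$, and the comultiplication of $\mathbb I_{\widetilde\times}$ is the diagonal. A bimonoid $(b,\mu_b,u_b,\Delta_b,\varepsilon_b)$ is an object $b$ that is a monoid for $\widetilde\times$ and a comonoid for $\times_A$, such that $\varepsilon_b$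 is a morphism of monoids, $u_b$ is a morphism of comonoids, and $\Delta_b\circ\mu_b=(\mu_b\times_A\mu_b)\circ\zeta\circ(\Delta_b\,\widetilde\times\,\Delta_b)$, with $\zeta$ the interchange law. Write $-x=\operatorname{op}\circ x$, and let $$\widetilde\gamma_{x,y}:x\times_A(-y)\to(x\,\widetilde\times\,y)\,\widetilde\times\,\mathbb I_{\times_A},\qquad \overline\gamma_{x,y}:(-x)\times_A y\to\mathbb I_{\times_A}\,\widetilde\times\,(x\,\widetilde\times\,y)$$ be the natural transformations given on points by $(u,v)\mapsto(u,v,x(u))$ and $(u,v)\mapsto(y(v),u,v)$. (1) An object $q:M\to A$ of $\mathrm{Sch}|_{qc}A$ is a bimonoid if and only if $M$ is a monoid scheme over $\Bbbk$ and $q$ is a morphism of monoid schemes. More precisely: the multiplication and the unit of a bimonoid make $M$ a monoid scheme for which $q$ is a morphism of monoid schemes, and every monoid scheme structure on $M$ for which $q$ is a morphism of monoid schemes arises in this way from exactly one bimonoid structure on $q$. (2) Let $b:M\to A$ be a bimonoid in $\mathrm{Sch}|_{qc}A$. Then $b$ is a morphism of group schemes (that is, the monoid scheme $M$ is a group scheme)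 if and only if $b$ has an antipode, i.e. a morphism $\iota_b:b\to -b$ of $\mathrm{Sch}|_{qc}A$ with $$(\mu_b\,\widetilde\times\,\mathrm{id})\circ\widetilde\gamma_{b,b}\circ(\mathrm{id}\times_A\iota_b)\circ\Delta_b=(u_b\,\widetilde\times\,\mathrm{id})\circ\lambda^{-1}\circ\varepsilon_b,$$ $$(\mathrm{id}\,\widetilde\times\,\mu_b)\circ\overline\gamma_{b,b}\circ(\iota_b\times_A\mathrm{id})\circ\Delta_b=(\mathrm{id}\,\widetilde\times\,u_b)\circ\rho^{-1}\circ\varepsilon_b,$$ where $\lambda:\mathbb I_{\widetilde\times}\,\widetilde\times\,\mathbb I_{\times_A}\to\mathbb I_{\times_A}$ and $\rho:\mathbb I_{\times_A}\,\widetilde\times\,\mathbb I_{\widetilde\times}\to\mathbb I_{\times_A}$ are the unit isomorphisms. (3) Consequently $b$ is a quasi-compact group extension of $A$, i.e. a surjective quasi-compact morphism of group schemes, if and only if $b$ is surjective and has an antipode. -/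

import Mathlib

open CategoryTheory CategoryTheory.Limits AlgebraicGeometry

noncomputable section

namespace DuoidalExt

universe v u

section Abbreviations

/-! Since a duoidal category carries two monoidal structures on the same category, the monoidal
structure in use is always named explicitly. -/

variable {C : Type u} [Category.{v} C] (M : MonoidalCategory C)

/-- The tensor product of two objects for the monoidal structure `M`. -/
abbrev ten (x y : C) : C := M.tensorObj x y

/-- The unit object of the monoidal structure `M`. -/
abbrev unitOb : C := M.tensorUnit

variable {M} in
/-- The tensor product of two morphisms for the monoidal structure `M`. -/
abbrev tenHom (M : MonoidalCategory C) {x x' y y' : C} (f : x ⟶ x') (g : y ⟶ y') :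
    ten M x y ⟶ ten M x' y' := M.tensorHom f g

/-- The associativity constraint of `M`. -/
abbrev assoc (x y z : C) : ten M (ten M x y) z ≅ ten M x (ten M y z) := M.associator x y z

/-- The left unit constraint of `M`. -/
abbrev lunit (x : C) : ten M (unitOb M) x ≅ x := M.leftUnitor x

/-- The right unit constraint of `M`. -/
abbrev runit (x : C) : ten M x (unitOb M) ≅ x := M.rightUnitor x

end Abbreviations

/-- A duoidal category structure `(C, ⋄, I_⋄, ⋆, I_⋆)` on the category `C`. -/
structure DuoidalCategory (C : Type u) [Category.{v} C] where
  /-- the monoidal structure `⋄` -/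
  dia : MonoidalCategory C
  /-- the monoidal structure `⋆` -/
  sta : MonoidalCategory C
  /-- the interchange law -/
  zeta (a b c d : C) :
    ten dia (ten sta a b) (ten sta c d) ⟶ ten sta (ten dia a c) (ten dia b d)
  zeta_natural {a a' b b' c c' d d' : C} (f : a ⟶ a') (g : b ⟶ b') (h : c ⟶ c') (k : d ⟶ d') :
    tenHom dia (tenHom sta f g) (tenHom sta h k) ≫ zeta a' b' c' d' =
      zeta a b c d ≫ tenHom sta (tenHom dia f h) (tenHom dia g k)
  /-- the unit object of `⋆` is a monoid for `⋄`, with multiplication `μ_⋆` and unit `u` -/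
  unitMon : @MonObj C _ dia (unitOb sta)
  /-- the unit object of `⋄` is a comonoid for `⋆`, with comultiplication `Δ_⋄` and counit `ε` -/
  unitComon : @ComonObj C _ sta (unitOb dia)
  /-- the unit `u` and the counit `ε` are the same morphism `I_⋄ ⟶ I_⋆` -/
  unit_eq_counit : unitMon.one = unitComon.counit
  zeta_assoc_dia (a b c d e f : C) :
    tenHom dia (zeta a b c d) (𝟙 (ten sta e f)) ≫ zeta (ten dia a c) (ten dia b d) e f ≫
        tenHom sta (assoc dia a c e).hom (assoc dia b d f).hom =
      (assoc dia (ten sta a b) (ten sta c d) (ten sta e f)).hom ≫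
        tenHom dia (𝟙 (ten sta a b)) (zeta c d e f) ≫ zeta a b (ten dia c e) (ten dia d f)
  zeta_assoc_sta (a b c d e f : C) :
    zeta (ten sta a b) c (ten sta d e) f ≫
        tenHom sta (zeta a b d e) (𝟙 (ten dia c f)) ≫
        (assoc sta (ten dia a d) (ten dia b e) (ten dia c f)).hom =
      tenHom dia (assoc sta a b c).hom (assoc sta d e f).hom ≫
        zeta a (ten sta b c) d (ten sta e f) ≫
        tenHom sta (𝟙 (ten dia a d)) (zeta b c e f)
  zeta_dia_unit_left (a b : C) :
    tenHom dia unitComon.comul (𝟙 (ten sta a b)) ≫ zeta (unitOb dia) (unitOb dia) a b ≫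
        tenHom sta (lunit dia a).hom (lunit dia b).hom =
      (lunit dia (ten sta a b)).hom
  zeta_dia_unit_right (a b : C) :
    tenHom dia (𝟙 (ten sta a b)) unitComon.comul ≫ zeta a b (unitOb dia) (unitOb dia) ≫
        tenHom sta (runit dia a).hom (runit dia b).hom =
      (runit dia (ten sta a b)).hom
  zeta_sta_unit_left (a b : C) :
    zeta (unitOb sta) a (unitOb sta) b ≫ tenHom sta unitMon.mul (𝟙 (ten dia a b)) ≫
        (lunit sta (ten dia a b)).hom =
      tenHom dia (lunit sta a).hom (lunit sta b).hom
  zeta_sta_unit_right (a b : C) :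
    zeta a (unitOb sta) b (unitOb sta) ≫ tenHom sta (𝟙 (ten dia a b)) unitMon.mul ≫
        (runit sta (ten dia a b)).hom =
      tenHom dia (runit sta a).hom (runit sta b).hom

/-- A bimonoid structure on the object `b` of a duoidal category. -/
structure DuoidalCategory.Bimonoid {C : Type u} [Category.{v} C] (D : DuoidalCategory C)
    (b : C) where
  /-- `(b, μ_b, u_b)` is a monoid for `⋄` -/
  mon : @MonObj C _ D.dia b
  /-- `(b, Δ_b, ε_b)` is a comonoid for `⋆` -/
  comon : @ComonObj C _ D.sta b
  /-- `ε_b` is a morphism of monoids for `⋄` -/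
  counit_isMonHom : @IsMonHom C _ D.dia b (unitOb D.sta) mon D.unitMon comon.counit
  /-- `u_b` is a morphism of comonoids for `⋆` -/
  unit_isComonHom : @IsComonHom C _ D.sta (unitOb D.dia) b D.unitComon comon mon.one
  mul_comul : mon.mul ≫ comon.comul =
    tenHom D.dia comon.comul comon.comul ≫ D.zeta b b b b ≫ tenHom D.sta mon.mul mon.mul

/-- The restriction of a duoidal structure to a full subcategory that contains both unit objects
and is closed under both tensor products. -/
abbrev DuoidalCategory.restrict {C : Type u} [Category.{v} C] (D : DuoidalCategory C)
    (P : ObjectProperty C)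
    (hd : @ObjectProperty.IsMonoidal C _ D.dia P) (hs : @ObjectProperty.IsMonoidal C _ D.sta P) :
    DuoidalCategory P.FullSubcategory where
  dia := @ObjectProperty.fullMonoidalSubcategory C _ D.dia P hd
  sta := @ObjectProperty.fullMonoidalSubcategory C _ D.sta P hs
  zeta a b c d := ObjectProperty.homMk (D.zeta a.obj b.obj c.obj d.obj)
  zeta_natural f g h k := ObjectProperty.hom_ext _ (D.zeta_natural f.hom g.hom h.hom k.hom)
  unitMon :=
    letI := @ObjectProperty.fullMonoidalSubcategory C _ D.dia P hd
    { one := ObjectProperty.homMk D.unitMon.one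
      mul := ObjectProperty.homMk D.unitMon.mul
      one_mul := ObjectProperty.hom_ext _ D.unitMon.one_mul
      mul_one := ObjectProperty.hom_ext _ D.unitMon.mul_one
      mul_assoc := ObjectProperty.hom_ext _ D.unitMon.mul_assoc }
  unitComon :=
    letI := @ObjectProperty.fullMonoidalSubcategory C _ D.sta P hs
    { counit := ObjectProperty.homMk D.unitComon.counit
      comul := ObjectProperty.homMk D.unitComon.comul
      counit_comul := ObjectProperty.hom_ext _ D.unitComon.counit_comul
      comul_counit := ObjectProperty.hom_ext _ D.unitComon.comul_counit
      comul_assoc := ObjectProperty.hom_ext _ D.unitComon.comul_assoc }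
  unit_eq_counit := ObjectProperty.hom_ext _ D.unit_eq_counit
  zeta_assoc_dia a b c d e f :=
    ObjectProperty.hom_ext _ (D.zeta_assoc_dia a.obj b.obj c.obj d.obj e.obj f.obj)
  zeta_assoc_sta a b c d e f :=
    ObjectProperty.hom_ext _ (D.zeta_assoc_sta a.obj b.obj c.obj d.obj e.obj f.obj)
  zeta_dia_unit_left a b := ObjectProperty.hom_ext _ (D.zeta_dia_unit_left a.obj b.obj)
  zeta_dia_unit_right a b := ObjectProperty.hom_ext _ (D.zeta_dia_unit_right a.obj b.obj)
  zeta_sta_unit_left a b := ObjectProperty.hom_ext _ (D.zeta_sta_unit_left a.obj b.obj)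
  zeta_sta_unit_right a b := ObjectProperty.hom_ext _ (D.zeta_sta_unit_right a.obj b.obj)

section OfCartesian

variable {C : Type u} [Category.{v} C]

section Helpers

variable (M : MonoidalCategory C)

lemma tenHom_comp {x y z x' y' z' : C} (f : x ⟶ y) (g : y ⟶ z) (f' : x' ⟶ y') (g' : y' ⟶ z') :
    tenHom M f f' ≫ tenHom M g g' = tenHom M (f ≫ g) (f' ≫ g') :=
  M.tensorHom_comp_tensorHom _ _ _ _

lemma assoc_natural {x y z x' y' z' : C} (f : x ⟶ x') (g : y ⟶ y') (h : z ⟶ z') :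
    tenHom M (tenHom M f g) h ≫ (assoc M x' y' z').hom =
      (assoc M x y z).hom ≫ tenHom M f (tenHom M g h) :=
  M.associator_naturality _ _ _

lemma lunit_natural {x y : C} (f : x ⟶ y) :
    tenHom M (𝟙 (unitOb M)) f ≫ (lunit M y).hom = (lunit M x).hom ≫ f := by
  rw [show tenHom M (𝟙 (unitOb M)) f = M.whiskerLeft (unitOb M) f from MonoidalCategory.id_tensorHom _ _]
  exact M.leftUnitor_naturality f

lemma runit_natural {x y : C} (f : x ⟶ y) :
    tenHom M f (𝟙 (unitOb M)) ≫ (runit M y).hom = (runit M x).hom ≫ f := by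
  rw [show tenHom M f (𝟙 (unitOb M)) = M.whiskerRight f (unitOb M) from MonoidalCategory.tensorHom_id _ _]
  exact M.rightUnitor_naturality f

end Helpers

section Helpers

variable (S : CartesianMonoidalCategory C)

abbrev pr1 (x y : C) : ten S.toMonoidalCategory x y ⟶ x := S.fst x y
abbrev pr2 (x y : C) : ten S.toMonoidalCategory x y ⟶ y := S.snd x y
abbrev pair {z x y : C} (f : z ⟶ x) (g : z ⟶ y) : z ⟶ ten S.toMonoidalCategory x y := S.lift f g
abbrev toOne (x : C) : x ⟶ unitOb S.toMonoidalCategory :=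
  SemiCartesianMonoidalCategory.toUnit x

lemma pair_pr1 {z x y : C} (f : z ⟶ x) (g : z ⟶ y) : pair S f g ≫ pr1 S x y = f := S.lift_fst _ _
lemma pair_pr2 {z x y : C} (f : z ⟶ x) (g : z ⟶ y) : pair S f g ≫ pr2 S x y = g := S.lift_snd _ _
lemma pair_ext {z x y : C} {f g : z ⟶ ten S.toMonoidalCategory x y}
    (h1 : f ≫ pr1 S x y = g ≫ pr1 S x y) (h2 : f ≫ pr2 S x y = g ≫ pr2 S x y) : f = g :=
  S.hom_ext _ _ h1 h2
lemma toOne_ext {x : C} (f g : x ⟶ unitOb S.toMonoidalCategory) : f = g :=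
  CartesianMonoidalCategory.toUnit_unique f g

lemma map_pr1 {x y x' y' : C} (f : x ⟶ x') (g : y ⟶ y') :
    tenHom S.toMonoidalCategory f g ≫ pr1 S x' y' = pr1 S x y ≫ f :=
  CartesianMonoidalCategory.tensorHom_fst f g
lemma map_pr2 {x y x' y' : C} (f : x ⟶ x') (g : y ⟶ y') :
    tenHom S.toMonoidalCategory f g ≫ pr2 S x' y' = pr2 S x y ≫ g :=
  CartesianMonoidalCategory.tensorHom_snd f g
lemma assoc_pr1 (x y z : C) : (assoc S.toMonoidalCategory x y z).hom ≫ pr1 S _ _ =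
    pr1 S _ _ ≫ pr1 S _ _ := CartesianMonoidalCategory.associator_hom_fst x y z
lemma assoc_pr2_pr1 (x y z : C) : (assoc S.toMonoidalCategory x y z).hom ≫ pr2 S _ _ ≫ pr1 S _ _ =
    pr1 S _ _ ≫ pr2 S _ _ := CartesianMonoidalCategory.associator_hom_snd_fst x y z
lemma assoc_pr2_pr2 (x y z : C) : (assoc S.toMonoidalCategory x y z).hom ≫ pr2 S _ _ ≫ pr2 S _ _ =
    pr2 S _ _ := CartesianMonoidalCategory.associator_hom_snd_snd x y z
lemma lunit_eq (x : C) : (lunit S.toMonoidalCategory x).hom = pr2 S _ _ :=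
  CartesianMonoidalCategory.leftUnitor_hom x
lemma runit_eq (x : C) : (runit S.toMonoidalCategory x).hom = pr1 S _ _ :=
  CartesianMonoidalCategory.rightUnitor_hom x

/-- Every object is a comonoid for the product, with the diagonal as comultiplication. -/
abbrev diagComon (x : C) : @ComonObj C _ S.toMonoidalCategory x :=
  { counit := toOne S x
    comul := pair S (𝟙 x) (𝟙 x)
    counit_comul := by
      rw [← cancel_mono (lunit S.toMonoidalCategory x).hom]
      simp [lunit_eq]
    comul_counit := by
      rw [← cancel_mono (runit S.toMonoidalCategory x).hom]
      simp [runit_eq]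
    comul_assoc := by
      apply pair_ext
      · simp
      · apply pair_ext <;> simp }

lemma diagComon_comul (x : C) : (diagComon S x).comul = pair S (𝟙 x) (𝟙 x) := rfl

end Helpers

/-- Every monoidal structure `⋄` on a category with chosen finite products is part of a duoidal
structure whose second monoidal structure `⋆` is the product. The interchange law is the morphism
`(a ⋆ b) ⋄ (c ⋆ d) ⟶ (a ⋄ c) ⋆ (b ⋄ d)` with components `p_a ⋄ p_c` and `p_b ⋄ p_d`; the
multiplication and the unit of `I_⋆` are the unique morphisms to the terminal object `I_⋆`; the
comultiplication of `I_⋄` is the diagonal. -/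
abbrev DuoidalCategory.ofCartesian (M : MonoidalCategory C) (S : CartesianMonoidalCategory C) :
    DuoidalCategory C where
  dia := M
  sta := S.toMonoidalCategory
  zeta a b c d := pair S (tenHom M (pr1 S a b) (pr1 S c d)) (tenHom M (pr2 S a b) (pr2 S c d))
  zeta_natural f g h k := by
    apply pair_ext S
    · rw [Category.assoc, Category.assoc, pair_pr1, map_pr1, ← Category.assoc (pair S _ _),
        pair_pr1, tenHom_comp, tenHom_comp, map_pr1, map_pr1]
    · rw [Category.assoc, Category.assoc, pair_pr2, map_pr2, ← Category.assoc (pair S _ _),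
        pair_pr2, tenHom_comp, tenHom_comp, map_pr2, map_pr2]
  unitMon := @MonObj.mk C _ M (unitOb S.toMonoidalCategory) (toOne S _) (toOne S _)
    (toOne_ext S _ _) (toOne_ext S _ _) (toOne_ext S _ _)
  unitComon := diagComon S (unitOb M)
  unit_eq_counit := rfl
  zeta_assoc_dia a b c d e f := by
    apply pair_ext S
    · simp only [Category.assoc, map_pr1, pair_pr1, reassoc_of% (pair_pr1 S),
        reassoc_of% (tenHom_comp M), tenHom_comp, Category.id_comp, assoc_natural]
    · simp only [Category.assoc, map_pr2, pair_pr2, reassoc_of% (pair_pr2 S),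
        reassoc_of% (tenHom_comp M), tenHom_comp, Category.id_comp, assoc_natural]
  zeta_assoc_sta a b c d e f := by
    apply pair_ext S
    · simp only [Category.assoc, map_pr1, pair_pr1, assoc_pr1, reassoc_of% (map_pr1 S),
        reassoc_of% (pair_pr1 S), tenHom_comp, Category.comp_id]
    · apply pair_ext S
      · simp only [Category.assoc, map_pr2, pair_pr1, pair_pr2, assoc_pr2_pr1,
          reassoc_of% (map_pr1 S),
          reassoc_of% (pair_pr1 S), reassoc_of% (pair_pr2 S), tenHom_comp]
      · simp only [Category.assoc, map_pr2, pair_pr2, assoc_pr2_pr2, Category.comp_id,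
          reassoc_of% (pair_pr2 S), tenHom_comp]
  zeta_dia_unit_left a b := by
    apply pair_ext S
    · simp only [Category.assoc, map_pr1, reassoc_of% (pair_pr1 S), pair_pr1, diagComon_comul,
        reassoc_of% (tenHom_comp M), Category.id_comp, lunit_natural]
    · simp only [Category.assoc, map_pr2, reassoc_of% (pair_pr2 S), pair_pr2, diagComon_comul,
        reassoc_of% (tenHom_comp M), Category.id_comp, lunit_natural]
  zeta_dia_unit_right a b := by
    apply pair_ext S
    · simp only [Category.assoc, map_pr1, reassoc_of% (pair_pr1 S), pair_pr1, diagComon_comul,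
        reassoc_of% (tenHom_comp M), Category.id_comp, runit_natural]
    · simp only [Category.assoc, map_pr2, reassoc_of% (pair_pr2 S), pair_pr2, diagComon_comul,
        reassoc_of% (tenHom_comp M), Category.id_comp, runit_natural]
  zeta_sta_unit_left a b := by
    simp only [lunit_eq, map_pr2, pair_pr2, Category.comp_id]
  zeta_sta_unit_right a b := by
    simp only [runit_eq, map_pr1, pair_pr1, Category.comp_id]

end OfCartesian

lemma unit_pullback_fst {C : Type u} [Category.{v} C] [HasPullbacks C] {X Y : C} (c : X ⟶ Y) {z : Over X} {w : Over Y}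
    (f : (Over.map c).obj z ⟶ w) :
    ((Over.mapPullbackAdj c).unit.app z ≫ (Over.pullback c).map f).left ≫ pullback.fst w.hom c =
      f.left := by
  have h := ((Over.mapPullbackAdj c).homEquiv z w).symm_apply_apply f
  rw [Adjunction.homEquiv_counit, Adjunction.homEquiv_unit] at h
  refine Eq.trans ?_ (congrArg (fun t ↦ t.left) h)
  rw [Over.comp_left, Over.comp_left, Over.mapPullbackAdj_counit_app]
  rfl

section Slice

open MonoidalCategory CartesianMonoidalCategory MonObj

variable {C : Type u} [Category.{v} C] [CartesianMonoidalCategory C]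

lemma cauchy_associativity {A X Y Z : C} [MonObj A] (x : X ⟶ A) (y : Y ⟶ A) (z : Z ⟶ A) :
    (α_ X Y Z).hom ≫ (x ⊗ₘ ((y ⊗ₘ z) ≫ μ[A])) ≫ μ[A] = (((x ⊗ₘ y) ≫ μ[A]) ⊗ₘ z) ≫ μ[A] := by
  have h1 : x ⊗ₘ ((y ⊗ₘ z) ≫ μ[A]) = (x ⊗ₘ (y ⊗ₘ z)) ≫ A ◁ μ[A] := by
    simp [← id_tensorHom]
  have h2 : ((x ⊗ₘ y) ≫ μ[A]) ⊗ₘ z = ((x ⊗ₘ y) ⊗ₘ z) ≫ μ[A] ▷ A := by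
    simp only [← tensorHom_id, tensorHom_comp_tensorHom, Category.comp_id]
  rw [h1, h2, Category.assoc, Category.assoc, MonObj.mul_assoc, ← associator_naturality_assoc]

/-- The data of the Cauchy monoidal structure. -/
abbrev cauchyStruct (A : C) [MonObj A] : MonoidalCategoryStruct (Over A) where
  tensorObj x y := Over.mk ((x.hom ⊗ₘ y.hom) ≫ μ[A])
  whiskerLeft x _ _ f := Over.homMk (x.left ◁ f.left) (by
    simp [← id_tensorHom])
  whiskerRight f y := Over.homMk (f.left ▷ y.left) (by
    simp [← tensorHom_id])
  tensorHom f g := Over.homMk (f.left ⊗ₘ g.left) (by simp)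
  tensorUnit := Over.mk η[A]
  associator x y z := Over.isoMk (α_ x.left y.left z.left)
    (cauchy_associativity x.hom y.hom z.hom)
  leftUnitor x := Over.isoMk (λ_ x.left) (by
    simp [MonoidalCategory.tensorHom_def'])
  rightUnitor x := Over.isoMk (ρ_ x.left) (by
    simp [MonoidalCategory.tensorHom_def])

/-- The Cauchy monoidal structure on the category of objects over a monoid object `A`:
`(x : X ⟶ A) ⋄ (y : Y ⟶ A)` is `X × Y ⟶ A × A ⟶ A`, the second arrow being the
multiplication of `A`, and the unit object is the unit `𝟙 ⟶ A`. -/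
abbrev cauchy (A : C) [MonObj A] : MonoidalCategory (Over A) :=
  letI := cauchyStruct A
  Monoidal.induced (Over.forget A)
    { μIso _ _ := Iso.refl _
      εIso := Iso.refl _
      whiskerLeft_eq _ _ _ _ := ((Category.id_comp _).trans (Category.comp_id _)).symm
      whiskerRight_eq _ _ := ((Category.id_comp _).trans (Category.comp_id _)).symm
      tensorHom_eq _ _ := ((Category.id_comp _).trans (Category.comp_id _)).symm
      associator_eq x y z := by
        change (α_ x.left y.left z.left).hom =
          (𝟙 _ ≫ (𝟙 (x.left ⊗ y.left) ⊗ₘ 𝟙 z.left)) ≫ (α_ x.left y.left z.left).hom ≫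
            (𝟙 x.left ⊗ₘ 𝟙 (y.left ⊗ z.left)) ≫ 𝟙 _
        simp
      leftUnitor_eq x := by
        change (λ_ x.left).hom = (𝟙 _ ≫ (𝟙 (𝟙_ C) ⊗ₘ 𝟙 x.left)) ≫ (λ_ x.left).hom
        simp
      rightUnitor_eq x := by
        change (ρ_ x.left).hom = (𝟙 _ ≫ (𝟙 x.left ⊗ₘ 𝟙 (𝟙_ C))) ≫ (ρ_ x.left).hom
        simp }

/-- The duoidal category of objects over a monoid object `A`, for the Cauchy product and the
fibered product over `A` (with unit object `𝟙 : A ⟶ A`), the Hadamard product. -/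
abbrev sliceDuoidal [HasPullbacks C] (A : C) [MonObj A] : DuoidalCategory (Over A) :=
  DuoidalCategory.ofCartesian (cauchy A) (Over.cartesianMonoidalCategory A)

/-- The multiplication of the unit object of the fibered product is that of `A`. -/
lemma sliceDuoidal_mul [HasPullbacks C] (A : C) [MonObj A] :
    (sliceDuoidal A).unitMon.mul.left = μ[A] := by
  change (𝟙 A ⊗ₘ 𝟙 A) ≫ μ[A] = μ[A]
  simp

/-- The unit of the unit object of the fibered product is that of `A`. -/
lemma sliceDuoidal_one [HasPullbacks C] (A : C) [MonObj A] :
    (sliceDuoidal A).unitMon.one.left = η[A] := rfl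

section Antipode

variable [HasPullbacks C] (A : C)

/-- The Hadamard product `x ×_A y` of objects over `A`. -/
abbrev had (x y : Over A) : Over A := ten (Over.cartesianMonoidalCategory A).toMonoidalCategory x y

/-- The unit object `𝟙 : A ⟶ A` of the Hadamard product. -/
abbrev hadUnit : Over A := unitOb (Over.cartesianMonoidalCategory A).toMonoidalCategory

variable {A} in
/-- The canonical morphism `π = ⟨p_X, p_Y⟩ : X ×_A Y ⟶ X × Y` from the fibered product of two
objects `x : X ⟶ A` and `y : Y ⟶ A`. -/
def proj (x y : Over A) : (had A x y).left ⟶ x.left ⊗ y.left :=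
  lift (pr1 (Over.cartesianMonoidalCategory A) x y).left
    (pr2 (Over.cartesianMonoidalCategory A) x y).left

variable {A} in
lemma proj_natural {x x' y y' : Over A} (f : x ⟶ x') (g : y ⟶ y') :
    (tenHom (Over.cartesianMonoidalCategory A).toMonoidalCategory f g).left ≫ proj x' y' =
      proj x y ≫ (f.left ⊗ₘ g.left) := by
  have h1 := congrArg (fun t ↦ t.left) (map_pr1 (Over.cartesianMonoidalCategory A) f g)
  have h2 := congrArg (fun t ↦ t.left) (map_pr2 (Over.cartesianMonoidalCategory A) f g)
  refine (comp_lift _ _ _).trans (Eq.trans ?_ (lift_map _ _ _ _).symm)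
  exact congrArg₂ _ h1 h2

variable [GrpObj A]

/-- The Cauchy product of objects over `A`. -/
abbrev cau (x y : Over A) : Over A := ten (cauchy A) x y

/-- The functor `x ↦ -x`, composition with the inversion `A ⟶ A`. -/
abbrev opSlice : Over A ⥤ Over A := Over.map ι[A]

variable {A}

lemma proj_mul_left (x y : Over A) :
    proj x ((opSlice A).obj y) ≫ (x.hom ⊗ₘ y.hom) ≫ μ[A] = toUnit _ ≫ η[A] := by
  have h1 := Over.w (pr1 (Over.cartesianMonoidalCategory A) x ((opSlice A).obj y))
  have h2 : (pr2 (Over.cartesianMonoidalCategory A) x ((opSlice A).obj y)).left ≫ y.hom ≫ ι[A] =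
      (had A x ((opSlice A).obj y)).hom :=
    Over.w (pr2 (Over.cartesianMonoidalCategory A) x ((opSlice A).obj y))
  have h : (pr1 (Over.cartesianMonoidalCategory A) x ((opSlice A).obj y)).left ≫ x.hom =
      ((pr2 (Over.cartesianMonoidalCategory A) x ((opSlice A).obj y)).left ≫ y.hom) ≫ ι[A] := by
    rw [h1, Category.assoc, h2]
  refine (lift_map_assoc _ _ _ _ _).trans ?_
  rw [h]
  exact GrpObj.lift_comp_inv_left _

lemma proj_mul_right (x y : Over A) :
    proj ((opSlice A).obj x) y ≫ (x.hom ⊗ₘ y.hom) ≫ μ[A] = toUnit _ ≫ η[A] := by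
  have h1 := Over.w (pr2 (Over.cartesianMonoidalCategory A) ((opSlice A).obj x) y)
  have h2 : (pr1 (Over.cartesianMonoidalCategory A) ((opSlice A).obj x) y).left ≫ x.hom ≫ ι[A] =
      (had A ((opSlice A).obj x) y).hom :=
    Over.w (pr1 (Over.cartesianMonoidalCategory A) ((opSlice A).obj x) y)
  have h : (pr2 (Over.cartesianMonoidalCategory A) ((opSlice A).obj x) y).left ≫ y.hom =
      ((pr1 (Over.cartesianMonoidalCategory A) ((opSlice A).obj x) y).left ≫ x.hom) ≫ ι[A] := by
    rw [h1, Category.assoc, h2]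
  refine (lift_map_assoc _ _ _ _ _).trans ?_
  rw [h]
  exact GrpObj.lift_comp_inv_right _

/-- The morphism `γ̃ = ⟨π, x ×_A (-y)⟩`, from `X ×_A Y⁻` to `(X × Y) × A`. On points it is
`(u, v) ↦ (u, v, x(u))`, where `x(u) = -y(v)`. -/
def gammaTildeHom (x y : Over A) :
    had A x ((opSlice A).obj y) ⟶ cau A (cau A x y) (hadUnit A) :=
  Over.homMk (lift (proj x ((opSlice A).obj y)) (had A x ((opSlice A).obj y)).hom) (by
    change lift _ _ ≫ (((x.hom ⊗ₘ y.hom) ≫ μ[A]) ⊗ₘ 𝟙 A) ≫ μ[A] = _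
    rw [lift_map_assoc, proj_mul_left, Category.comp_id]
    exact one_mul (M := _ ⟶ A) _)

/-- The morphism `γ̄ = ⟨(-x) ×_A y, π⟩`, from `X⁻ ×_A Y` to `A × (X × Y)`. On points it is
`(u, v) ↦ (y(v), u, v)`, where `y(v) = -x(u)`. -/
def gammaBarHom (x y : Over A) :
    had A ((opSlice A).obj x) y ⟶ cau A (hadUnit A) (cau A x y) :=
  Over.homMk (lift (had A ((opSlice A).obj x) y).hom (proj ((opSlice A).obj x) y)) (by
    change lift _ _ ≫ (𝟙 A ⊗ₘ ((x.hom ⊗ₘ y.hom) ≫ μ[A])) ≫ μ[A] = _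
    rw [lift_map_assoc, proj_mul_right, Category.comp_id]
    exact mul_one (M := _ ⟶ A) _)

lemma gammaTildeHom_natural {x x' y y' : Over A} (f : x ⟶ x') (g : y ⟶ y') :
    tenHom (Over.cartesianMonoidalCategory A).toMonoidalCategory f ((opSlice A).map g) ≫
        gammaTildeHom x' y' =
      gammaTildeHom x y ≫ tenHom (cauchy A) (tenHom (cauchy A) f g) (𝟙 (hadUnit A)) := by
  apply Over.OverMorphism.ext
  refine (comp_lift _ _ _).trans (Eq.trans ?_ (lift_map _ _ _ _).symm)
  refine congrArg₂ _ (proj_natural f ((opSlice A).map g)) ?_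
  exact (Over.w _).trans (Category.comp_id _).symm

lemma gammaBarHom_natural {x x' y y' : Over A} (f : x ⟶ x') (g : y ⟶ y') :
    tenHom (Over.cartesianMonoidalCategory A).toMonoidalCategory ((opSlice A).map f) g ≫
        gammaBarHom x' y' =
      gammaBarHom x y ≫ tenHom (cauchy A) (𝟙 (hadUnit A)) (tenHom (cauchy A) f g) := by
  apply Over.OverMorphism.ext
  refine (comp_lift _ _ _).trans (Eq.trans ?_ (lift_map _ _ _ _).symm)
  refine congrArg₂ _ ?_ (proj_natural ((opSlice A).map f) g)
  exact (Over.w _).trans (Category.comp_id _).symm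

/-! The morphisms `γ̃` and `γ̄` are also obtained from `π` by adjunction, through the constant
endomorphism `c₀` of `A` with value `0`. -/

variable (A) in
/-- The constant morphism `A ⟶ A` equal to the unit of `A`. -/
abbrev constZero : A ⟶ A := toUnit A ≫ η[A]

/-- `π` as a morphism `(c₀)_* (x ×_A (-y)) ⟶ x ⋄ y`. -/
def projTilde (x y : Over A) :
    (Over.map (constZero A)).obj (had A x ((opSlice A).obj y)) ⟶ cau A x y :=
  Over.homMk (proj x ((opSlice A).obj y)) (by
    refine (proj_mul_left x y).trans ?_
    change _ = _ ≫ toUnit A ≫ η[A]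
    rw [← Category.assoc, comp_toUnit])

/-- `π` as a morphism `(c₀)_* ((-x) ×_A y) ⟶ x ⋄ y`. -/
def projBar (x y : Over A) :
    (Over.map (constZero A)).obj (had A ((opSlice A).obj x) y) ⟶ cau A x y :=
  Over.homMk (proj ((opSlice A).obj x) y) (by
    refine (proj_mul_right x y).trans ?_
    change _ = _ ≫ toUnit A ≫ η[A]
    rw [← Category.assoc, comp_toUnit])

/-- The natural morphism `ρ : (c₀)^* z ⟶ z ⋄ I`, with `I` the unit object of `×_A`. -/
def rhoTilde (z : Over A) : (Over.pullback (constZero A)).obj z ⟶ cau A z (hadUnit A) :=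
  Over.homMk (lift (pullback.fst z.hom (constZero A)) (pullback.snd z.hom (constZero A))) (by
    change lift _ _ ≫ (z.hom ⊗ₘ 𝟙 A) ≫ μ[A] = pullback.snd z.hom (constZero A)
    rw [lift_map_assoc, pullback.condition, ← Category.assoc, Category.comp_id, comp_toUnit]
    exact one_mul (M := _ ⟶ A) _)

/-- The natural morphism `(c₀)^* z ⟶ I ⋄ z`, with `I` the unit object of `×_A`. -/
def rhoBar (z : Over A) : (Over.pullback (constZero A)).obj z ⟶ cau A (hadUnit A) z :=
  Over.homMk (lift (pullback.snd z.hom (constZero A)) (pullback.fst z.hom (constZero A))) (by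
    change lift _ _ ≫ (𝟙 A ⊗ₘ z.hom) ≫ μ[A] = pullback.snd z.hom (constZero A)
    rw [lift_map_assoc, pullback.condition, ← Category.assoc, Category.comp_id, comp_toUnit]
    exact mul_one (M := _ ⟶ A) _)

lemma gammaTildeHom_eq (x y : Over A) :
    gammaTildeHom x y =
      (Over.mapPullbackAdj (constZero A)).unit.app (had A x ((opSlice A).obj y)) ≫
        (Over.pullback (constZero A)).map (projTilde x y) ≫ rhoTilde (cau A x y) := by
  apply Over.OverMorphism.ext
  have h1 : ((Over.mapPullbackAdj (constZero A)).unit.app (had A x ((opSlice A).obj y)) ≫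
      (Over.pullback (constZero A)).map (projTilde x y)).left ≫
        pullback.fst (cau A x y).hom (constZero A) = proj x ((opSlice A).obj y) := by
    exact unit_pullback_fst _ _
  have h2 : ((Over.mapPullbackAdj (constZero A)).unit.app (had A x ((opSlice A).obj y)) ≫
      (Over.pullback (constZero A)).map (projTilde x y)).left ≫
        pullback.snd (cau A x y).hom (constZero A) = (had A x ((opSlice A).obj y)).hom := by
    exact Over.w ((Over.mapPullbackAdj (constZero A)).unit.app (had A x ((opSlice A).obj y)) ≫
      (Over.pullback (constZero A)).map (projTilde x y))
  rw [← Category.assoc, Over.comp_left]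
  exact (congrArg₂ lift h1.symm h2.symm).trans (comp_lift _ _ _).symm

lemma gammaBarHom_eq (x y : Over A) :
    gammaBarHom x y =
      (Over.mapPullbackAdj (constZero A)).unit.app (had A ((opSlice A).obj x) y) ≫
        (Over.pullback (constZero A)).map (projBar x y) ≫ rhoBar (cau A x y) := by
  apply Over.OverMorphism.ext
  have h1 : ((Over.mapPullbackAdj (constZero A)).unit.app (had A ((opSlice A).obj x) y) ≫
      (Over.pullback (constZero A)).map (projBar x y)).left ≫
        pullback.fst (cau A x y).hom (constZero A) = proj ((opSlice A).obj x) y := by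
    exact unit_pullback_fst _ _
  have h2 : ((Over.mapPullbackAdj (constZero A)).unit.app (had A ((opSlice A).obj x) y) ≫
      (Over.pullback (constZero A)).map (projBar x y)).left ≫
        pullback.snd (cau A x y).hom (constZero A) = (had A ((opSlice A).obj x) y).hom := by
    exact Over.w ((Over.mapPullbackAdj (constZero A)).unit.app (had A ((opSlice A).obj x) y) ≫
      (Over.pullback (constZero A)).map (projBar x y))
  rw [← Category.assoc, Over.comp_left]
  exact (congrArg₂ lift h2.symm h1.symm).trans (comp_lift _ _ _).symm

end Antipode

end Slice


section SchemesOver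

open MonoidalCategory CartesianMonoidalCategory MonObj

variable {k : Type u} [Field k]

/-- An abelian variety over `k` is a smooth, connected, proper group scheme over `k` (of finite
type, which is part of properness). -/
class IsAbelianVariety (A : Over (Spec (.of k))) [GrpObj A] : Prop where
  smooth : Smooth A.hom
  proper : IsProper A.hom
  connected : ConnectedSpace A.left

variable (A : Over (Spec (.of k)))

/-- The property of being quasi-compact over `A`. -/
def quasiCompactOver : ObjectProperty (Over A) := fun x ↦ QuasiCompact x.hom.left

/-- The category of quasi-compact schemes over the `k`-scheme `A`. -/
abbrev SchQc : Type _ := (quasiCompactOver A).FullSubcategory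

lemma qc_unit [GrpObj A] : QuasiCompact η[A].left := inferInstance

lemma qc_mul [GrpObj A] [hA : IsAbelianVariety A] : QuasiCompact μ[A].left := by
  have := hA.proper
  have : IsProper (A ⊗ A).hom := by dsimp; infer_instance
  have : QuasiCompact (μ[A].left ≫ A.hom) := by rw [Over.w]; infer_instance
  exact .of_comp _ A.hom

lemma cauchy_isMonoidal [GrpObj A] [IsAbelianVariety A] :
    @ObjectProperty.IsMonoidal _ _ (cauchy A) (quasiCompactOver A) :=
  letI := cauchy A
  { prop_unit := qc_unit A
    prop_tensor x y hx hy := by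
      have := qc_mul A
      have : QuasiCompact x.hom.left := hx
      have : QuasiCompact y.hom.left := hy
      change QuasiCompact (((x.hom ⊗ₘ y.hom) ≫ μ[A]).left)
      have : QuasiCompact (x.hom ⊗ₘ y.hom).left := by
        rw [Over.tensorHom_left]
        exact MorphismProperty.pullbackMap (P := @QuasiCompact) hx hy
          (Over.w x.hom).symm (Over.w y.hom).symm
      rw [Over.comp_left]
      infer_instance }

lemma hadamard_isMonoidal :
    @ObjectProperty.IsMonoidal _ _ (Over.cartesianMonoidalCategory A).toMonoidalCategory
      (quasiCompactOver A) :=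
  letI := (Over.cartesianMonoidalCategory A).toMonoidalCategory
  { prop_unit := by
      change QuasiCompact (𝟙 A : A ⟶ A).left
      rw [Over.id_left]
      infer_instance
    prop_tensor x y hx hy := by
      have : QuasiCompact x.hom.left := hx
      have : QuasiCompact y.hom.left := hy
      change QuasiCompact (pullback.fst x.hom y.hom ≫ x.hom).left
      have h := (IsPullback.of_hasPullback x.hom y.hom).map (Over.forget _)
      have : QuasiCompact (pullback.fst x.hom y.hom).left :=
        MorphismProperty.of_isPullback (P := @QuasiCompact) h.flip hy
      rw [Over.comp_left]
      infer_instance }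

/-- The duoidal category of quasi-compact schemes over the abelian variety `A`, with the Cauchy
product and the fibered product over `A`. -/
abbrev schQcDuoidal [GrpObj A] [IsAbelianVariety A] : DuoidalCategory (SchQc A) :=
  (sliceDuoidal A).restrict (quasiCompactOver A) (cauchy_isMonoidal A) (hadamard_isMonoidal A)

variable [GrpObj A] [IsAbelianVariety A]

/-- The functor `x ↦ -x` on quasi-compact schemes over `A`: `-x` is the composition of
`x : X ⟶ A` with the inversion of `A`. -/
def opSchQc : SchQc A ⥤ SchQc A :=
  ObjectProperty.lift (quasiCompactOver A) ((quasiCompactOver A).ι ⋙ opSlice A) (fun x ↦ by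
    have : QuasiCompact x.obj.hom.left := x.property
    have : IsIso ι[A].left := (Over.forget _).map_isIso ι[A]
    change QuasiCompact (x.obj.hom ≫ ι[A]).left
    rw [Over.comp_left]
    infer_instance)

/-- The natural transformation `γ̃_{x,y} : x ×_A (-y) ⟶ (x ⋄ y) ⋄ I`, with `I` the unit object of
the fibered product. -/
def gammaTilde :
    (𝟭 (SchQc A)).prod (opSchQc A) ⋙ @tensor (SchQc A) _ (schQcDuoidal A).sta ⟶
      @tensor (SchQc A) _ (schQcDuoidal A).dia ⋙
        @tensorRight (SchQc A) _ (schQcDuoidal A).dia (unitOb (schQcDuoidal A).sta) where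
  app p := ObjectProperty.homMk (gammaTildeHom p.1.obj p.2.obj)
  naturality p q f := by
    apply ObjectProperty.hom_ext
    refine (gammaTildeHom_natural f.1.hom f.2.hom).trans ?_
    exact congrArg _ (@tensorHom_id _ _ (cauchy A) _ _ _ _)

/-- The natural transformation `γ̄_{x,y} : (-x) ×_A y ⟶ I ⋄ (x ⋄ y)`, with `I` the unit object of
the fibered product. -/
def gammaBar :
    (opSchQc A).prod (𝟭 (SchQc A)) ⋙ @tensor (SchQc A) _ (schQcDuoidal A).sta ⟶
      @tensor (SchQc A) _ (schQcDuoidal A).dia ⋙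
        @tensorLeft (SchQc A) _ (schQcDuoidal A).dia (unitOb (schQcDuoidal A).sta) where
  app p := ObjectProperty.homMk (gammaBarHom p.1.obj p.2.obj)
  naturality p q f := by
    apply ObjectProperty.hom_ext
    refine (gammaBarHom_natural f.1.hom f.2.hom).trans ?_
    exact congrArg _ (@id_tensorHom _ _ (cauchy A) _ _ _ _)

variable {A}

/-- The total scheme `M` of an object `q : M ⟶ A`, as a scheme over `k`. -/
abbrev total (x : SchQc A) : Over (Spec (.of k)) := x.obj.left

/-- The structure morphism `q : M ⟶ A`. -/
abbrev str (x : SchQc A) : total x ⟶ A := x.obj.hom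

/-- The unit `Spec k ⟶ M` of a bimonoid `M ⟶ A`. -/
abbrev bimonOne {x : SchQc A} (b : (schQcDuoidal A).Bimonoid x) :
    𝟙_ (Over (Spec (.of k))) ⟶ total x := b.mon.one.hom.left

/-- The multiplication `M × M ⟶ M` of a bimonoid `M ⟶ A`. -/
abbrev bimonMul {x : SchQc A} (b : (schQcDuoidal A).Bimonoid x) :
    total x ⊗ total x ⟶ total x := b.mon.mul.hom.left

/-- An antipode for the bimonoid `b`: a morphism `b ⟶ -b` such that the two antipode diagrams
commute. -/
structure IsAntipode {x : SchQc A} (b : (schQcDuoidal A).Bimonoid x)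
    (i : x ⟶ (opSchQc A).obj x) : Prop where
  right :
    b.comon.comul ≫ tenHom (schQcDuoidal A).sta (𝟙 x) i ≫ (gammaTilde A).app (x, x) ≫
        tenHom (schQcDuoidal A).dia b.mon.mul (𝟙 (unitOb (schQcDuoidal A).sta)) =
      b.comon.counit ≫ (lunit (schQcDuoidal A).dia (unitOb (schQcDuoidal A).sta)).inv ≫
        tenHom (schQcDuoidal A).dia b.mon.one (𝟙 (unitOb (schQcDuoidal A).sta))
  left :
    b.comon.comul ≫ tenHom (schQcDuoidal A).sta i (𝟙 x) ≫ (gammaBar A).app (x, x) ≫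
        tenHom (schQcDuoidal A).dia (𝟙 (unitOb (schQcDuoidal A).sta)) b.mon.mul =
      b.comon.counit ≫ (runit (schQcDuoidal A).dia (unitOb (schQcDuoidal A).sta)).inv ≫
        tenHom (schQcDuoidal A).dia (𝟙 (unitOb (schQcDuoidal A).sta)) b.mon.one

/-- The bimonoid `b : M ⟶ A` is a (quasi-compact) morphism of group schemes: `M`, with the unit and
the multiplication of the bimonoid, has an inversion morphism that makes it a group scheme over
`k`, and `M ⟶ A` is a morphism of group schemes. -/
def IsGroupMorphism {x : SchQc A} (b : (schQcDuoidal A).Bimonoid x) : Prop :=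
  ∃ G : GrpObj (total x), G.one = bimonOne b ∧ G.mul = bimonMul b ∧ IsMonHom (str x)

/-- The bimonoid `b : M ⟶ A` is a quasi-compact group extension of `A`: a surjective quasi-compact
morphism of group schemes. -/
def IsQuasiCompactExtension {x : SchQc A} (b : (schQcDuoidal A).Bimonoid x) : Prop :=
  IsGroupMorphism b ∧ Surjective (str x).left ∧ QuasiCompact (str x).left

end SchemesOver

end DuoidalExt
end

/-! The comonoid half of a bimonoid carries no information here. The second tensor product is the
categorical product of objects over `A`, so the two counit laws force the comultiplication to be the
diagonal (`comul_hom_eq_diag`), and the counit is the unique map to the terminal object `id : A ⟶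
A`. Conversely every monoid, with its diagonal, satisfies the bimonoid axioms (`bimonoidOfMon`). A
bimonoid is thus a monoid for the Cauchy product. Since the Cauchy product of `X ⟶ A` and `Y ⟶ A`
lives on `X × Y`, such a monoid is a monoid scheme `M` whose unit and multiplication are morphisms
over `A`, and this condition says exactly that `q : M ⟶ A` preserves unit and multiplication.

For the antipode, each diagram is evaluated on points. With `Δ` the diagonal, the first one compares
`u ↦ (u · i(u), q(u))` with `u ↦ (e, q(u))`, and the second compares `u ↦ (q(u), i(u) · u)` with `u
↦ (q(u), e)`. The components in `A` always agree, so the diagrams say that `i` is a two-sided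
inversion on `M` (`isAntipode_iff`). An inversion is automatically a morphism `M ⟶ -M` over `A`,
because a morphism of groups satisfies `q(u⁻¹) = -q(u)`. The statement on extensions then only adds
surjectivity on both sides, quasi-compactness being built into the category. -/

namespace DuoidalExt

universe v u

/-! ### Bimonoids when the second tensor product is the categorical product -/

section Cocommutative

variable {C : Type u} [Category.{v} C] (S : CartesianMonoidalCategory C)

/-- A comonoid for the product on a full subcategory has the diagonal as comultiplication. -/
lemma comul_hom_eq_diag {P : ObjectProperty C}
    (hs : @ObjectProperty.IsMonoidal C _ S.toMonoidalCategory P) {x : P.FullSubcategory}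
    (c : @ComonObj _ _ (@ObjectProperty.fullMonoidalSubcategory C _ S.toMonoidalCategory P hs) x) :
    c.comul.hom = pair S (𝟙 x.obj) (𝟙 x.obj) := by
  apply pair_ext S
  · have h : c.comul.hom ≫ S.whiskerLeft x.obj c.counit.hom =
        (runit S.toMonoidalCategory x.obj).inv :=
      congrArg (fun t ↦ t.hom) c.comul_counit
    rw [pair_pr1]
    -- Whiskering with the counit leaves the first projection unchanged, so it may be inserted in
    -- front of it. The counit law then turns the composite into the inverse right unitor followed
    -- by the first projection, which is the right unitor.
    refine (congrArg (c.comul.hom ≫ ·)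
      (CartesianMonoidalCategory.whiskerLeft_fst x.obj c.counit.hom).symm).trans ?_
    refine (Category.assoc _ _ _).symm.trans ((congrArg (· ≫ pr1 S _ _) h).trans ?_)
    exact (congrArg (_ ≫ ·) (runit_eq S x.obj).symm).trans
      (runit S.toMonoidalCategory x.obj).inv_hom_id
  · have h : c.comul.hom ≫ S.whiskerRight c.counit.hom x.obj =
        (lunit S.toMonoidalCategory x.obj).inv :=
      congrArg (fun t ↦ t.hom) c.counit_comul
    rw [pair_pr2]
    refine (congrArg (c.comul.hom ≫ ·)
      (CartesianMonoidalCategory.whiskerRight_snd c.counit.hom x.obj).symm).trans ?_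
    refine (Category.assoc _ _ _).symm.trans ((congrArg (· ≫ pr2 S _ _) h).trans ?_)
    exact (congrArg (_ ≫ ·) (lunit_eq S x.obj).symm).trans
      (lunit S.toMonoidalCategory x.obj).inv_hom_id

/-- The diagonal comonoid structure on an object of a full subcategory. -/
abbrev diagComonRestrict {P : ObjectProperty C}
    (hs : @ObjectProperty.IsMonoidal C _ S.toMonoidalCategory P) (x : P.FullSubcategory) :
    @ComonObj _ _ (@ObjectProperty.fullMonoidalSubcategory C _ S.toMonoidalCategory P hs) x :=
  letI := @ObjectProperty.fullMonoidalSubcategory C _ S.toMonoidalCategory P hs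
  { counit := ObjectProperty.homMk (diagComon S x.obj).counit
    comul := ObjectProperty.homMk (diagComon S x.obj).comul
    counit_comul := ObjectProperty.hom_ext _ (diagComon S x.obj).counit_comul
    comul_counit := ObjectProperty.hom_ext _ (diagComon S x.obj).comul_counit
    comul_assoc := ObjectProperty.hom_ext _ (diagComon S x.obj).comul_assoc }

/-- Counits agree because the unit object is terminal, comultiplications because both are the
diagonal. This gives the uniqueness of the bimonoid structure. -/
lemma comonObj_eq {P : ObjectProperty C}
    (hs : @ObjectProperty.IsMonoidal C _ S.toMonoidalCategory P) {x : P.FullSubcategory}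
    (c c' : @ComonObj _ _
      (@ObjectProperty.fullMonoidalSubcategory C _ S.toMonoidalCategory P hs) x) : c = c' := by
  have h1 : c.counit = c'.counit := ObjectProperty.hom_ext _ (toOne_ext S _ _)
  have h2 : c.comul = c'.comul := ObjectProperty.hom_ext _
    ((comul_hom_eq_diag S hs c).trans (comul_hom_eq_diag S hs c').symm)
  cases c; cases c'
  cases h1; cases h2
  rfl

variable (M : MonoidalCategory C) {P : ObjectProperty C}
  (hd : @ObjectProperty.IsMonoidal C _ M P)
  (hs : @ObjectProperty.IsMonoidal C _ S.toMonoidalCategory P)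

/-- When the second monoidal structure is the product, every monoid for the first one is a
bimonoid, with the diagonal as comultiplication. -/
def bimonoidOfMon {x : P.FullSubcategory}
    (m : @MonObj _ _ (@ObjectProperty.fullMonoidalSubcategory C _ M P hd) x) :
    ((DuoidalCategory.ofCartesian M S).restrict P hd hs).Bimonoid x where
  mon := m
  comon := diagComonRestrict S hs x
  -- Both equations are between morphisms into the terminal object.
  counit_isMonHom :=
    letI := @ObjectProperty.fullMonoidalSubcategory C _ M P hd
    @IsMonHom.mk _ _ _ _ _ m
      ((DuoidalCategory.ofCartesian M S).restrict P hd hs).unitMon _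
      (ObjectProperty.hom_ext _ (toOne_ext S _ _)) (ObjectProperty.hom_ext _ (toOne_ext S _ _))
  unit_isComonHom :=
    letI := @ObjectProperty.fullMonoidalSubcategory C _ S.toMonoidalCategory P hs
    @IsComonHom.mk _ _ _ _ _
      ((DuoidalCategory.ofCartesian M S).restrict P hd hs).unitComon (diagComonRestrict S hs x) _
      (ObjectProperty.hom_ext _ (toOne_ext S _ _))
      (ObjectProperty.hom_ext _ (by
        change m.one.hom ≫ pair S (𝟙 _) (𝟙 _) =
          pair S (𝟙 _) (𝟙 _) ≫ tenHom S.toMonoidalCategory m.one.hom m.one.hom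
        apply pair_ext S
        · rw [Category.assoc, Category.assoc, pair_pr1, map_pr1, ← Category.assoc (pair S _ _),
            pair_pr1, Category.comp_id, Category.id_comp]
        · rw [Category.assoc, Category.assoc, pair_pr2, map_pr2, ← Category.assoc (pair S _ _),
            pair_pr2, Category.comp_id, Category.id_comp]))
  mul_comul := ObjectProperty.hom_ext _ (by
    change m.mul.hom ≫ pair S (𝟙 _) (𝟙 _) =
      tenHom M (pair S (𝟙 x.obj) (𝟙 x.obj)) (pair S (𝟙 x.obj) (𝟙 x.obj)) ≫
        pair S (tenHom M (pr1 S x.obj x.obj) (pr1 S x.obj x.obj))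
          (tenHom M (pr2 S x.obj x.obj) (pr2 S x.obj x.obj)) ≫
        tenHom S.toMonoidalCategory m.mul.hom m.mul.hom
    -- After either projection, `Δ ⋄ Δ` followed by the interchange law becomes `(Δ ≫ p) ⋄ (Δ ≫ p) =
    -- 𝟙 ⋄ 𝟙`, so both sides reduce to the multiplication.
    have hid : tenHom M (𝟙 x.obj) (𝟙 x.obj) = 𝟙 (ten M x.obj x.obj) :=
      M.id_tensorHom_id _ _
    apply pair_ext S
    · simp only [Category.assoc, pair_pr1, map_pr1, reassoc_of% (pair_pr1 S),
        reassoc_of% (tenHom_comp M), hid, Category.comp_id, Category.id_comp]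
    · simp only [Category.assoc, pair_pr2, map_pr2, reassoc_of% (pair_pr2 S),
        reassoc_of% (tenHom_comp M), hid, Category.comp_id, Category.id_comp])

/-- The comonoid parts agree by `comonObj_eq`, and the compatibility axioms are propositions, so
only the unit and the multiplication have to be compared. -/
lemma bimonoid_ext {x : P.FullSubcategory}
    {b b' : ((DuoidalCategory.ofCartesian M S).restrict P hd hs).Bimonoid x}
    (h1 : b.mon.one = b'.mon.one) (h2 : b.mon.mul = b'.mon.mul) : b = b' := by
  have hm : b.mon = b'.mon := by
    cases b with | mk m _ _ _ _ => cases b' with | mk m' _ _ _ _ =>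
    cases m; cases m'
    cases h1; cases h2
    rfl
  have hc : b.comon = b'.comon := comonObj_eq S hs _ _
  cases b; cases b'
  cases hm; cases hc
  rfl

end Cocommutative

/-! ### Monoids for the Cauchy product and monoid schemes over `A` -/

section SchemesOver

open MonoidalCategory CartesianMonoidalCategory MonObj

variable {k : Type u} [Field k] {A : Over (Spec (.of k))} [GrpObj A] [IsAbelianVariety A]
  {x : SchQc A}

/-- The monoid scheme underlying a monoid for the Cauchy product. -/
noncomputable abbrev totalMon (m : @MonObj _ _ (schQcDuoidal A).dia x) : MonObj (total x) where
  one := m.one.hom.left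
  mul := m.mul.hom.left
  -- The Cauchy tensor product, associator and unitors have those of the product over `k` as
  -- underlying data, by definition, so each law passes to `M` unchanged.
  one_mul := congrArg (fun t ↦ t.hom.left) m.one_mul
  mul_one := congrArg (fun t ↦ t.hom.left) m.mul_one
  mul_assoc := congrArg (fun t ↦ t.hom.left) m.mul_assoc

/-- The commuting triangles that make the unit and the multiplication morphisms over `A` are the two
conditions on `q`. -/
lemma isMonHom_str (m : @MonObj _ _ (schQcDuoidal A).dia x) :
    @IsMonHom _ _ _ _ _ (totalMon m) _ (str x) :=
  @IsMonHom.mk _ _ _ _ _ (totalMon m) _ _ (Over.w m.one.hom) (Over.w m.mul.hom)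

/-- A monoid scheme over the monoid scheme `A` is a monoid for the Cauchy product. -/
noncomputable abbrev cauchyMon (m : MonObj (total x)) (h : IsMonHom (str x)) :
    @MonObj _ _ (schQcDuoidal A).dia x :=
  letI := (schQcDuoidal A).dia
  { one := ObjectProperty.homMk (Over.homMk m.one h.one_hom)
    mul := ObjectProperty.homMk (Over.homMk m.mul h.mul_hom)
    one_mul := ObjectProperty.hom_ext _ (Over.OverMorphism.ext m.one_mul)
    mul_one := ObjectProperty.hom_ext _ (Over.OverMorphism.ext m.mul_one)
    mul_assoc := ObjectProperty.hom_ext _ (Over.OverMorphism.ext m.mul_assoc) }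

/-! ### The antipode diagrams and inversion on the monoid scheme -/

variable (b : (schQcDuoidal A).Bimonoid x)

/-- As `Δ` is the diagonal, the composite is the pairing of `f` and `g`. Composing with `π`
suffices, since `γ̃` and `γ̄` are built from `π` and the structure morphism to `A`. -/
lemma comul_tenHom_left {y z : SchQc A} (f : x ⟶ y) (g : x ⟶ z) :
    (b.comon.comul ≫ tenHom (schQcDuoidal A).sta f g).hom.left ≫ proj y.obj z.obj =
      lift f.hom.left g.hom.left := by
  have h := comul_hom_eq_diag (Over.cartesianMonoidalCategory A) (hadamard_isMonoidal A) b.comon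
  have h' : (b.comon.comul ≫ tenHom (schQcDuoidal A).sta f g).hom =
      pair (Over.cartesianMonoidalCategory A) f.hom g.hom := by
    change b.comon.comul.hom ≫
      tenHom (Over.cartesianMonoidalCategory A).toMonoidalCategory f.hom g.hom = _
    rw [h]
    apply pair_ext (Over.cartesianMonoidalCategory A)
    · rw [Category.assoc, map_pr1, ← Category.assoc, pair_pr1, pair_pr1, Category.id_comp]
    · rw [Category.assoc, map_pr2, ← Category.assoc, pair_pr2, pair_pr2, Category.id_comp]
  rw [h']
  refine (comp_lift _ _ _).trans ?_
  refine congrArg₂ _ ?_ ?_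
  · exact congrArg (fun t ↦ t.left) (pair_pr1 (Over.cartesianMonoidalCategory A) f.hom g.hom)
  · exact congrArg (fun t ↦ t.left) (pair_pr2 (Over.cartesianMonoidalCategory A) f.hom g.hom)

lemma comp_lift_tensorHom_id {C : Type u} [Category.{v} C] [CartesianMonoidalCategory C]
    {T Z X Y W : C} (t : T ⟶ Z) (p : Z ⟶ X) (a : Z ⟶ Y) (m : X ⟶ W) :
    t ≫ lift p a ≫ (m ⊗ₘ 𝟙 Y) = lift ((t ≫ p) ≫ m) (t ≫ a) := by
  simp

lemma comp_lift_id_tensorHom {C : Type u} [Category.{v} C] [CartesianMonoidalCategory C]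
    {T Z X Y W : C} (t : T ⟶ Z) (p : Z ⟶ X) (a : Z ⟶ Y) (m : X ⟶ W) :
    t ≫ lift a p ≫ (𝟙 Y ⊗ₘ m) = lift (t ≫ a) ((t ≫ p) ≫ m) := by
  simp

/-- On points, `u ↦ (u, i(u)) ↦ (u, i(u), q(u)) ↦ (u · i(u), q(u))`. -/
lemma antipode_right_lhs (i : x ⟶ (opSchQc A).obj x) :
    (b.comon.comul ≫ tenHom (schQcDuoidal A).sta (𝟙 x) i ≫ (gammaTilde A).app (x, x) ≫
      tenHom (schQcDuoidal A).dia b.mon.mul (𝟙 (unitOb (schQcDuoidal A).sta))).hom.left =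
    lift (lift (𝟙 (total x)) i.hom.left ≫ bimonMul b) (str x) := by
  rw [← Category.assoc]
  change (b.comon.comul ≫ tenHom (schQcDuoidal A).sta (𝟙 x) i).hom.left ≫
    lift (proj x.obj ((opSlice A).obj x.obj)) (had A x.obj ((opSlice A).obj x.obj)).hom ≫
      (bimonMul b ⊗ₘ 𝟙 A) = _
  refine (comp_lift_tensorHom_id _ _ _ _).trans ?_
  refine congrArg₂ _ (congrArg (· ≫ _) (comul_tenHom_left b (𝟙 x) i)) ?_
  -- The last component of `γ̃` is the structure morphism of the fibered product; preceded by a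
  -- morphism over `A`, it becomes `q`.
  exact Over.w (b.comon.comul ≫ tenHom (schQcDuoidal A).sta (𝟙 x) i).hom

lemma antipode_left_lhs (i : x ⟶ (opSchQc A).obj x) :
    (b.comon.comul ≫ tenHom (schQcDuoidal A).sta i (𝟙 x) ≫ (gammaBar A).app (x, x) ≫
      tenHom (schQcDuoidal A).dia (𝟙 (unitOb (schQcDuoidal A).sta)) b.mon.mul).hom.left =
    lift (str x) (lift i.hom.left (𝟙 (total x)) ≫ bimonMul (x := x) b) := by
  rw [← Category.assoc]
  change (b.comon.comul ≫ tenHom (schQcDuoidal A).sta i (𝟙 x)).hom.left ≫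
    lift (had A ((opSlice A).obj x.obj) x.obj).hom (proj ((opSlice A).obj x.obj) x.obj) ≫
      (𝟙 A ⊗ₘ bimonMul b) = _
  refine (comp_lift_id_tensorHom _ _ _ _).trans ?_
  refine congrArg₂ _ ?_ (congrArg (· ≫ _) (comul_tenHom_left b i (𝟙 x)))
  exact Over.w (b.comon.comul ≫ tenHom (schQcDuoidal A).sta i (𝟙 x)).hom

/-- The target is `id : A ⟶ A`, and a morphism over `A` into it can only be `q`. -/
lemma counit_left : b.comon.counit.hom.left = str x :=
  (Category.comp_id _).symm.trans (Over.w b.comon.counit.hom)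

lemma antipode_right_rhs :
    (b.comon.counit ≫ (lunit (schQcDuoidal A).dia (unitOb (schQcDuoidal A).sta)).inv ≫
      tenHom (schQcDuoidal A).dia b.mon.one (𝟙 (unitOb (schQcDuoidal A).sta))).hom.left =
    lift (toUnit _ ≫ bimonOne b) (str x) := by
  change b.comon.counit.hom.left ≫ (λ_ A).inv ≫ (bimonOne b ⊗ₘ 𝟙 A) = _
  rw [counit_left]
  ext <;> simp

lemma antipode_left_rhs :
    (b.comon.counit ≫ (runit (schQcDuoidal A).dia (unitOb (schQcDuoidal A).sta)).inv ≫
      tenHom (schQcDuoidal A).dia (𝟙 (unitOb (schQcDuoidal A).sta)) b.mon.one).hom.left =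
    lift (str x) (toUnit _ ≫ bimonOne b) := by
  change b.comon.counit.hom.left ≫ (ρ_ A).inv ≫ (𝟙 A ⊗ₘ bimonOne b) = _
  rw [counit_left]
  ext <;> simp

/-- The antipode diagrams say that the underlying morphism is a two-sided inverse of the identity
of the monoid scheme. -/
lemma isAntipode_iff (i : x ⟶ (opSchQc A).obj x) :
    IsAntipode b i ↔
      lift (𝟙 (total x)) i.hom.left ≫ bimonMul b = toUnit _ ≫ bimonOne b ∧
        lift i.hom.left (𝟙 (total x)) ≫ bimonMul (x := x) b = toUnit _ ≫ bimonOne b := by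
  constructor
  · intro h
    have h1 := congrArg (fun t ↦ t.hom.left) h.right
    have h2 := congrArg (fun t ↦ t.hom.left) h.left
    have h1 := (antipode_right_lhs b i).symm.trans (h1.trans (antipode_right_rhs b))
    have h2 := (antipode_left_lhs b i).symm.trans (h2.trans (antipode_left_rhs b))
    -- The components in `A` are `q` on both sides, so the equations are tested in `M`: first factor
    -- for the right diagram, second for the left.
    constructor
    · simpa only [lift_fst] using congrArg (· ≫ fst _ _) h1
    · simpa only [lift_snd] using congrArg (· ≫ snd _ _) h2
  · rintro ⟨h1, h2⟩
    constructor
    · apply ObjectProperty.hom_ext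
      apply Over.OverMorphism.ext
      exact (antipode_right_lhs b i).trans
        ((congrArg (lift · (str x)) h1).trans (antipode_right_rhs b).symm)
    · apply ObjectProperty.hom_ext
      apply Over.OverMorphism.ext
      exact (antipode_left_lhs b i).trans
        ((congrArg (lift (str x) ·) h2).trans (antipode_left_rhs b).symm)

lemma isGroupMorphism_iff_exists_antipode :
    IsGroupMorphism b ↔ ∃ i : x ⟶ (opSchQc A).obj x, IsAntipode b i := by
  constructor
  · rintro ⟨G, h1, h2, h3⟩
    -- Inversion on `M` is a morphism from `q` to `-q` over `A`: `q` commutes with inversions, and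
    -- inverting twice on `A` is the identity.
    have hw : ι[total x] ≫ str x ≫ ι[A] = str x := by
      have h := GrpObj.inv_hom (str x)
      rw [← Category.assoc, h, Category.assoc]
      simp
    refine ⟨ObjectProperty.homMk (Over.homMk ι[total x] hw), (isAntipode_iff b _).2 ⟨?_, ?_⟩⟩
    · rw [← h1, ← h2]
      exact G.right_inv
    · rw [← h1, ← h2]
      exact G.left_inv
  · rintro ⟨i, hi⟩
    obtain ⟨h1, h2⟩ := (isAntipode_iff b i).1 hi
    -- The total scheme of `-x` is `M` itself, so the morphism underlying `i` is an endomorphism of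
    -- `M` and can serve as inversion.
    exact ⟨{ totalMon b.mon with inv := i.hom.left, left_inv := h2, right_inv := h1 },
      rfl, rfl, isMonHom_str b.mon⟩

end SchemesOver

end DuoidalExt

theorem mainTheorem10 {k : Type*} [Field k] (A : Over (Spec (.of k))) [GrpObj A]
    [DuoidalExt.IsAbelianVariety A] (x : DuoidalExt.SchQc A) :
    -- bimonoid structures on `x : M ⟶ A` are the monoid scheme structures on `M` for which
    -- `M ⟶ A` is a morphism of monoid schemes
    ((∀ b : (DuoidalExt.schQcDuoidal A).Bimonoid x,
        ∃ m : MonObj (DuoidalExt.total x),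
          m.one = DuoidalExt.bimonOne b ∧ m.mul = DuoidalExt.bimonMul b ∧
            IsMonHom (DuoidalExt.str x)) ∧
      (∀ m : MonObj (DuoidalExt.total x), IsMonHom (DuoidalExt.str x) →
        ∃! b : (DuoidalExt.schQcDuoidal A).Bimonoid x,
          DuoidalExt.bimonOne b = m.one ∧ DuoidalExt.bimonMul b = m.mul)) ∧
    -- a bimonoid is a morphism of group schemes iff it has an antipode
    (∀ b : (DuoidalExt.schQcDuoidal A).Bimonoid x,
      DuoidalExt.IsGroupMorphism b ↔
        ∃ i : x ⟶ (DuoidalExt.opSchQc A).obj x, DuoidalExt.IsAntipode b i) ∧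
    -- a bimonoid is a quasi-compact group extension of `A` iff it is surjective with an antipode
    (∀ b : (DuoidalExt.schQcDuoidal A).Bimonoid x,
      DuoidalExt.IsQuasiCompactExtension b ↔
        Surjective (DuoidalExt.str x).left ∧
          ∃ i : x ⟶ (DuoidalExt.opSchQc A).obj x, DuoidalExt.IsAntipode b i) := by
  refine ⟨⟨fun b ↦ ⟨DuoidalExt.totalMon b.mon, rfl, rfl, DuoidalExt.isMonHom_str b.mon⟩,
    fun m h ↦ ⟨DuoidalExt.bimonoidOfMon _ _ _ _ (DuoidalExt.cauchyMon m h), ⟨rfl, rfl⟩, ?_⟩⟩,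
    DuoidalExt.isGroupMorphism_iff_exists_antipode, fun b ↦ ?_⟩
  · rintro b ⟨h1, h2⟩
    exact DuoidalExt.bimonoid_ext _ _ _ _
      (ObjectProperty.hom_ext _ (Over.OverMorphism.ext h1))
      (ObjectProperty.hom_ext _ (Over.OverMorphism.ext h2))
  · rw [← DuoidalExt.isGroupMorphism_iff_exists_antipode]
    -- Quasi-compactness of `q` is `x.property`, membership in the full subcategory.
    exact ⟨fun h ↦ ⟨h.2.1, h.1⟩, fun h ↦ ⟨h.2, h.1, x.property⟩⟩
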